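/- Let $C\subseteq\mathbb R^m$ be nonempty, closed and convex, and let $f:C\times C\to\mathbb R$ satisfy $f(x,x)=0$ for all $x\in C$. Assume: (SP) there is $\gamma>0$ such that for all $x,y\in C$, $f(x,y)\ge 0$ implies $f(y,x)\le-\gamma\|x-y\|^2$; (LC) there are $c_1,c_2>0$ such that $f(x,y)+f(y,z)\ge f(x,z)-c_1\|x-y\|^2-c_2\|y-z\|^2$ for all $x,y,z\in C$; for each $x\in C$ the function $f(x,\cdot)$ is convex and lower semicontinuous on $C$, and for each $y\in C$ the function $f(\cdot,y)$ is hemicontinuous on $C$ (continuous along every segment contained in $C$). Then there is exactly one $x^\dagger\in C$ with $f(x^\dagger,y)\ge 0$ for all $y\in C$. Moreover, put $\varphi=\frac{1+\sqrt5}{2}$, choose any $\bar x_{-1}\in\mathbb R^m$, $x_{-1},x_0\in C$, $\lambda_0>0$ and $\mu\in(0,\varphi/2)$, and for $n\ge 0$ let $$\bar x_n=\frac{(\varphi-1)x_n+\bar x_{n-1}}{\varphi},\qquad x_{n+1}=\operatorname*{arg\,min}_{y\in C}\Big\{\lambda_n f(x_n,y)+\tfrac12\|y-\bar x_n\|^2\Big\},$$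 $$\lambda_{n+1}=\min\left\{\lambda_n,\ \frac{\mu\left(\|x_{n-1}-x_n\|^2+\|x_n-x_{n+1}\|^2\right)}{2\left[f(x_{n-1},x_{n+1})-f(x_{n-1},x_n)-f(x_n,x_{n+1})\right]_+}\right\},$$ where $[t]_+=\max\{0,t\}$ and a quotient with denominator $0$ (including $0/0$) is $+\infty$. Then $(x_n)$ converges to $x^\dagger$ at least $R$-linearly, that is, $x_n\to x^\dagger$ and $\limsup_{n\to\infty}\|x_n-x^\dagger\|^{1/n}<1$. -/

import Mathlib

open Filter Topology Set

noncomputable section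

namespace EGRA

variable {m : ℕ}

/-- The solution set of the equilibrium problem: find `x ∈ C` with `f(x, y) ≥ 0` for all `y ∈ C`. -/
def solutions (C : Set (EuclideanSpace ℝ (Fin m)))
    (f : EuclideanSpace ℝ (Fin m) → EuclideanSpace ℝ (Fin m) → ℝ) :
    Set (EuclideanSpace ℝ (Fin m)) :=
  {x | x ∈ C ∧ ∀ y ∈ C, 0 ≤ f x y}

/-- `f` is strongly pseudomonotone on `C` with modulus `γ`. -/
def StronglyPseudomonotone (C : Set (EuclideanSpace ℝ (Fin m)))
    (f : EuclideanSpace ℝ (Fin m) → EuclideanSpace ℝ (Fin m) → ℝ) (γ : ℝ) : Prop :=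
  ∀ x ∈ C, ∀ y ∈ C, 0 ≤ f x y → f y x ≤ -γ * ‖x - y‖ ^ 2

/-- `f` satisfies the Lipschitz-type condition on `C` for some positive constants `c₁`, `c₂`. -/
def LipschitzType (C : Set (EuclideanSpace ℝ (Fin m)))
    (f : EuclideanSpace ℝ (Fin m) → EuclideanSpace ℝ (Fin m) → ℝ) : Prop :=
  ∃ c₁ c₂ : ℝ, 0 < c₁ ∧ 0 < c₂ ∧ ∀ x ∈ C, ∀ y ∈ C, ∀ z ∈ C,
    f x z - c₁ * ‖x - y‖ ^ 2 - c₂ * ‖y - z‖ ^ 2 ≤ f x y + f y z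

/-- `g` is hemicontinuous on the convex set `C`: continuous along each segment contained in `C`. -/
def HemicontinuousOnSegments (C : Set (EuclideanSpace ℝ (Fin m)))
    (g : EuclideanSpace ℝ (Fin m) → ℝ) : Prop :=
  ∀ x ∈ C, ∀ y ∈ C, ContinuousOn (fun t : ℝ => g (x + t • (y - x))) (Icc 0 1)

/-- `p = prox_{lam g}(z)`: the point `p` minimizes `lam g(y) + ½ ‖y - z‖²` over `y ∈ C`. -/
def IsProx (C : Set (EuclideanSpace ℝ (Fin m))) (g : EuclideanSpace ℝ (Fin m) → ℝ)
    (lam : ℝ) (z p : EuclideanSpace ℝ (Fin m)) : Prop :=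
  p ∈ C ∧ IsMinOn (fun y => lam * g y + (1 / 2) * ‖y - z‖ ^ 2) C p

/-- `min {lam, μ a / (2 [t]₊)}`, where a quotient with denominator `0` (including `0/0`) is `+∞`. -/
def nextStep (μ lam a t : ℝ) : ℝ :=
  if max 0 t = 0 then lam else min lam (μ * a / (2 * max 0 t))

/-- `x`, `xbar` (indexed from `-1`) and `lam` (indexed from `0`) are generated by the explicit
golden ratio algorithm with parameter `μ`. Only the indices `≥ -1` of `x` and `xbar` are used. -/
structure IsGenerated (C : Set (EuclideanSpace ℝ (Fin m)))
    (f : EuclideanSpace ℝ (Fin m) → EuclideanSpace ℝ (Fin m) → ℝ) (μ : ℝ)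
    (x xbar : ℤ → EuclideanSpace ℝ (Fin m)) (lam : ℕ → ℝ) : Prop where
  mu_pos : 0 < μ
  mu_lt : μ < Real.goldenRatio / 2
  lam_zero_pos : 0 < lam 0
  x_neg_one_mem : x (-1) ∈ C
  x_zero_mem : x 0 ∈ C
  xbar_eq : ∀ n : ℕ, xbar n =
    (Real.goldenRatio)⁻¹ • ((Real.goldenRatio - 1) • x n + xbar ((n : ℤ) - 1))
  x_succ : ∀ n : ℕ, IsProx C (f (x n)) (lam n) (xbar n) (x ((n : ℤ) + 1))
  lam_succ : ∀ n : ℕ, lam (n + 1) = nextStep μ (lam n)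
    (‖x ((n : ℤ) - 1) - x n‖ ^ 2 + ‖x n - x ((n : ℤ) + 1)‖ ^ 2)
    (f (x ((n : ℤ) - 1)) (x ((n : ℤ) + 1)) - f (x ((n : ℤ) - 1)) (x n)
      - f (x n) (x ((n : ℤ) + 1)))

/-- R-linear convergence: `u n → a` and `limsup ‖u n - a‖^{1/n} < 1`.
The limsup is taken in the extended reals, so that it always has its usual meaning. -/
def RLinearlyConvergesTo (u : ℕ → EuclideanSpace ℝ (Fin m))
    (a : EuclideanSpace ℝ (Fin m)) : Prop :=
  Tendsto u atTop (𝓝 a) ∧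
    limsup (fun n : ℕ => ((‖u n - a‖ ^ ((1 : ℝ) / (n : ℝ)) : ℝ) : EReal)) atTop < 1

end EGRA

end

/-!
Existence of a solution is a Knaster–Kuratowski–Mazurkiewicz argument. By strong pseudomonotonicity,
the sets `{x ∈ C | f y x + γ * ‖x - y‖ ^ 2 ≤ 0}` with `y ∈ C` cover convex hulls as the KKM lemma
requires (`convexHull_subset_iUnion_mintySet`); since `f y` is convex and lower
semicontinuous, they are closed, convex and, thanks to the quadratic term, bounded even when `C` is
not. For convex sets the KKM lemma needs only separation by hyperplanes (`kkm_convex`, by way of the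
Klee–Berge theorem `nonempty_iInter_of_convex_iUnion`). A common point of all the sets is a solution
by hemicontinuity (`nonneg_of_minty`), and strong pseudomonotonicity makes it unique.

For the algorithm, adding the variational inequalities of two consecutive proximal steps, with the
golden ratio identity `norm_sq_goldenRatio_average` for the averages, gives an energy estimate
(`energy_step`). The Lipschitz-type condition keeps the step sizes `lam n` above a positive bound,
and they decrease, so their consecutive ratios tend to `1`. Write `φ` for the golden ratio, `a` for
the solution, `B n = ‖xbar n - a‖ ^ 2` and `A n = ‖x n - x (n - 1)‖ ^ 2`. Because `2 μ < φ`, the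
estimate eventually reads
`φ ^ 2 * B (n + 1) + p * A (n + 1) + (good terms) ≤ φ ^ 2 * B n + s * A n` with `s < p`.
The good terms dominate a multiple of `B n`, hence `φ ^ 2 * B n + p * A n` decays geometrically, and
with it `‖x n - a‖ ^ 2`.
-/

namespace EGRA

/-! ### Intersections of convex sets -/

section KKM

variable {E : Type*} [NormedAddCommGroup E] [InnerProductSpace ℝ E]

/-- The **Klee–Berge intersection theorem**: finitely many compact convex sets whose union is convex
and nonempty have a common point as soon as any choice of all but one of them has one. If not, a
hyperplane separates one set strictly from the intersection of the others; the traces of these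
others on the hyperplane satisfy the same hypotheses, but have no common point. -/
theorem nonempty_iInter_of_convex_iUnion {ι : Type*} [DecidableEq ι] (s : Finset ι) :
    ∀ K : ι → Set E, (∀ i ∈ s, IsCompact (K i)) → (∀ i ∈ s, Convex ℝ (K i)) →
      Convex ℝ (⋃ i ∈ s, K i) → (⋃ i ∈ s, K i).Nonempty →
      (∀ j ∈ s, (⋂ i ∈ s.erase j, K i).Nonempty) → (⋂ i ∈ s, K i).Nonempty := by
  induction s using Finset.induction_on with
  | empty => intro K _ _ _ h; simp at h
  | insert a s ha ih =>
    intro K hcpt hconv hUconv hUne herase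
    rcases s.eq_empty_or_nonempty with rfl | ⟨j₀, hj₀⟩
    · simpa using hUne
    by_contra hne
    obtain ⟨q₀, hq₀⟩ := herase j₀ (Finset.mem_insert_of_mem hj₀)
    obtain ⟨p, hp⟩ := herase a (Finset.mem_insert_self a s)
    rw [Finset.erase_insert ha] at hp
    have haj : ∀ j ∈ s, a ∈ (insert a s).erase j := fun j hj =>
      Finset.mem_erase.2 ⟨fun h => ha (h ▸ hj), Finset.mem_insert_self a s⟩
    have hq₀a : q₀ ∈ K a := mem_iInter₂.1 hq₀ a (haj j₀ hj₀)
    have hBclosed : IsClosed (⋂ i ∈ s, K i) :=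
      isClosed_biInter fun i hi => (hcpt i (Finset.mem_insert_of_mem hi)).isClosed
    have hBconv : Convex ℝ (⋂ i ∈ s, K i) :=
      convex_iInter₂ fun i hi => hconv i (Finset.mem_insert_of_mem hi)
    have hdisj : Disjoint (K a) (⋂ i ∈ s, K i) := by
      rw [Set.disjoint_iff_inter_eq_empty, ← Set.not_nonempty_iff_eq_empty]
      simpa [Finset.set_biInter_insert] using hne
    obtain ⟨g, u, v, hgu, huv, hgv⟩ := geometric_hahn_banach_compact_closed
      (hconv a (Finset.mem_insert_self a s)) (hcpt a (Finset.mem_insert_self a s))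
      hBconv hBclosed hdisj
    -- A convex set with points on both sides of the hyperplane `g = v` meets it.
    have cross : ∀ D : Set E, Convex ℝ D → ∀ q ∈ D, ∀ r ∈ D, g q < v → v < g r →
        ∃ w ∈ D, g w = v := by
      intro D hD q hq r hr hqv hrv
      obtain ⟨w, hw, hwv⟩ := hD.isPreconnected.intermediate_value hq hr g.continuous.continuousOn
        ⟨hqv.le, hrv.le⟩
      exact ⟨w, hw, hwv⟩
    have hH : Convex ℝ {w | g w = v} := 
      (convex_singleton (𝕜 := ℝ) v).is_linear_preimage g.toLinearMap.isLinear
    have hUeq : (⋃ i ∈ s, K i ∩ {w | g w = v}) = (⋃ i ∈ insert a s, K i) ∩ {w | g w = v} := by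
      rw [Finset.set_biUnion_insert, Set.union_inter_distrib_right, Set.iUnion₂_inter]
      have : K a ∩ {w | g w = v} = ∅ := by
        ext w
        rw [mem_empty_iff_false, iff_false]
        rintro ⟨hw, hwv⟩
        exact ((hgu w hw).trans huv).ne hwv
      rw [this, Set.empty_union]
    obtain ⟨w, hw⟩ := ih (fun i => K i ∩ {w | g w = v})
      (fun i hi => (hcpt i (Finset.mem_insert_of_mem hi)).inter_right
        (isClosed_eq g.continuous continuous_const))
      (fun i hi => (hconv i (Finset.mem_insert_of_mem hi)).inter hH)
      (by rw [hUeq]; exact hUconv.inter hH)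
      (by
        rw [hUeq]
        obtain ⟨w, hw, hwv⟩ := cross _ hUconv q₀
          (mem_iUnion₂.2 ⟨a, Finset.mem_insert_self a s, hq₀a⟩) p
          (mem_iUnion₂.2 ⟨j₀, Finset.mem_insert_of_mem hj₀, mem_iInter₂.1 hp j₀ hj₀⟩)
          ((hgu q₀ hq₀a).trans huv) (hgv p hp)
        exact ⟨w, hw, hwv⟩)
      (by
        intro j hj
        obtain ⟨q, hq⟩ := herase j (Finset.mem_insert_of_mem hj)
        have hqa : q ∈ K a := mem_iInter₂.1 hq a (haj j hj)
        obtain ⟨w, hw, hwv⟩ := cross (⋂ i ∈ s.erase j, K i)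
          (convex_iInter₂ fun i hi =>
            hconv i (Finset.mem_insert_of_mem (Finset.mem_of_mem_erase hi))) q
          (mem_iInter₂.2 fun i hi => mem_iInter₂.1 hq i
            (Finset.erase_subset_erase j (Finset.subset_insert a s) hi)) p
          (mem_iInter₂.2 fun i hi => mem_iInter₂.1 hp i (Finset.mem_of_mem_erase hi))
          ((hgu q hqa).trans huv) (hgv p hp)
        exact ⟨w, mem_iInter₂.2 fun i hi => ⟨mem_iInter₂.1 hw i hi, hwv⟩⟩)
    have hwB : w ∈ ⋂ i ∈ s, K i := mem_iInter₂.2 fun i hi => (mem_iInter₂.1 hw i hi).1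
    exact (hgv w hwB).ne' (mem_iInter₂.1 hw j₀ hj₀).2

/-- The **Knaster–Kuratowski–Mazurkiewicz lemma for convex sets**, in which convexity of the values
allows a proof from the Klee–Berge theorem, without Brouwer's fixed point theorem. -/
theorem kkm_convex [DecidableEq E] (s : Finset E) :
    ∀ K : E → Set E, s.Nonempty → (∀ i ∈ s, IsClosed (K i)) → (∀ i ∈ s, Convex ℝ (K i)) →
      (∀ t ⊆ s, convexHull ℝ (t : Set E) ⊆ ⋃ i ∈ t, K i) →
      (⋂ i ∈ s, K i ∩ convexHull ℝ (s : Set E)).Nonempty := by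
  induction s using Finset.strongInduction with
  | H s ih =>
    intro K hs hclosed hconv hcover
    have hUeq : (⋃ i ∈ s, K i ∩ convexHull ℝ (s : Set E)) = convexHull ℝ (s : Set E) := by
      rw [← Set.iUnion₂_inter]
      exact Set.inter_eq_right.2 (hcover s subset_rfl)
    refine nonempty_iInter_of_convex_iUnion s (fun i => K i ∩ convexHull ℝ (s : Set E))
      (fun i hi => (s.finite_toSet.isCompact_convexHull (𝕜 := ℝ)).inter_left (hclosed i hi))
      (fun i hi => (hconv i hi).inter (convex_convexHull ℝ _))
      (by rw [hUeq]; exact convex_convexHull ℝ _)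
      (by rw [hUeq]; exact convexHull_nonempty_iff.2 hs.to_set) ?_
    intro j hj
    rcases (s.erase j).eq_empty_or_nonempty with h | h
    · simp [h]
    · obtain ⟨w, hw⟩ := ih (s.erase j) (Finset.erase_ssubset hj) K h
        (fun i hi => hclosed i (Finset.mem_of_mem_erase hi))
        (fun i hi => hconv i (Finset.mem_of_mem_erase hi))
        (fun t ht => hcover t (ht.trans (Finset.erase_subset j s)))
      exact ⟨w, mem_iInter₂.2 fun i hi => ⟨(mem_iInter₂.1 hw i hi).1,
        convexHull_mono (by exact_mod_cast Finset.erase_subset j s) (mem_iInter₂.1 hw i hi).2⟩⟩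

end KKM

/-! ### The equilibrium problem -/

section Equilibrium

variable {m : ℕ} {C : Set (EuclideanSpace ℝ (Fin m))}
  {f : EuclideanSpace ℝ (Fin m) → EuclideanSpace ℝ (Fin m) → ℝ} {γ : ℝ}

/-- The quadratically strengthened Minty set of `y`. The term `γ ‖x - y‖ ^ 2`, which strong
pseudomonotonicity provides, makes this set bounded. -/
def mintySet (C : Set (EuclideanSpace ℝ (Fin m)))
    (f : EuclideanSpace ℝ (Fin m) → EuclideanSpace ℝ (Fin m) → ℝ) (γ : ℝ)
    (y : EuclideanSpace ℝ (Fin m)) : Set (EuclideanSpace ℝ (Fin m)) :=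
  {x | x ∈ C ∧ f y x + γ * ‖x - y‖ ^ 2 ≤ 0}

theorem convexOn_norm_sub_sq (hC : Convex ℝ C) (y : EuclideanSpace ℝ (Fin m)) :
    ConvexOn ℝ C (fun x => ‖x - y‖ ^ 2) := by
  have h := (convexOn_univ_norm (E := EuclideanSpace ℝ (Fin m))).translate_left (-y)
  have h2 := h.pow (fun x _ => norm_nonneg _) 2
  refine (h2.subset (by simp) hC).congr ?_
  intro x _
  simp [sub_eq_add_neg]

theorem convex_mintySet (hC : Convex ℝ C) (hγ : 0 < γ) {y : EuclideanSpace ℝ (Fin m)}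
    (hf : ConvexOn ℝ C (f y)) : Convex ℝ (mintySet C f γ y) :=
  (hf.add ((convexOn_norm_sub_sq hC y).smul hγ.le)).convex_le 0

theorem isClosed_mintySet (hC : IsClosed C) {y : EuclideanSpace ℝ (Fin m)}
    (hf : LowerSemicontinuousOn (f y) C) : IsClosed (mintySet C f γ y) := by
  have h : LowerSemicontinuousOn (fun x => f y x + γ * ‖x - y‖ ^ 2) C :=
    hf.add ((show Continuous fun x => γ * ‖x - y‖ ^ 2 by
      fun_prop).lowerSemicontinuous.lowerSemicontinuousOn C)
  obtain ⟨v, hv, hCv⟩ := lowerSemicontinuousOn_iff_preimage_Iic.1 h 0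
  have : mintySet C f γ y = C ∩ v := by rw [← hCv]; rfl
  rw [this]
  exact hC.inter hv

/-- Lower semicontinuity bounds `f y` below near `y`, and convexity turns this into a lower bound
on `f y` that is linear in the distance to `y`. Hence `γ ‖x - y‖ ^ 2` dominates far from `y`. -/
theorem isBounded_mintySet (hC : Convex ℝ C) (hγ : 0 < γ) {y : EuclideanSpace ℝ (Fin m)}
    (hy : y ∈ C) (hyy : f y y = 0) (hfc : ConvexOn ℝ C (f y))
    (hf : LowerSemicontinuousOn (f y) C) : Bornology.IsBounded (mintySet C f γ y) := by
  have h1 := hf y hy (-1) (show (-1 : ℝ) < f y y by rw [hyy]; norm_num)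
  obtain ⟨δ, hδ, hball⟩ := Metric.mem_nhdsWithin_iff.1 h1
  refine (Metric.isBounded_closedBall (x := y) (r := max δ (2 / (γ * δ)))).subset ?_
  rintro x ⟨hx, hle⟩
  rw [mem_closedBall_iff_norm]
  by_contra! hlt
  have hr1 : δ < ‖x - y‖ := (le_max_left _ _).trans_lt hlt
  have hr2 : 2 / (γ * δ) < ‖x - y‖ := (le_max_right _ _).trans_lt hlt
  have hr : 0 < ‖x - y‖ := hδ.trans hr1
  set t := δ / (2 * ‖x - y‖) with ht
  have ht0 : 0 < t := by positivity
  have ht1 : t ≤ 1 := by rw [ht, div_le_one (by positivity)]; linarith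
  have hmem : (1 - t) • y + t • x ∈ C := hC hy hx (by linarith) ht0.le (by ring)
  have hdist : (1 - t) • y + t • x ∈ Metric.ball y δ := by
    rw [mem_ball_iff_norm]
    have : (1 - t) • y + t • x - y = t • (x - y) := by module
    rw [this, norm_smul, Real.norm_of_nonneg ht0.le, ht]
    field_simp
    linarith
  have h2 : -1 < f y ((1 - t) • y + t • x) := hball ⟨hdist, hmem⟩
  have h3 := hfc.2 hy hx (by linarith : 0 ≤ 1 - t) ht0.le (by ring)
  simp only [hyy, smul_eq_mul, mul_zero, zero_add] at h3
  have h4 : t * (γ * ‖x - y‖ ^ 2) < 1 := by nlinarith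
  have h5 : t * (γ * ‖x - y‖ ^ 2) = γ * δ * ‖x - y‖ / 2 := by rw [ht]; field_simp
  rw [div_lt_iff₀ (by positivity)] at hr2
  rw [h5] at h4
  linarith

/-- The strengthened Minty sets have the KKM covering property: at a point `z` outside all of them,
strong pseudomonotonicity gives `f z y < 0` for every `y ∈ t`, and so `f z z < 0`. -/
theorem convexHull_subset_iUnion_mintySet (hC : Convex ℝ C) (hdiag : ∀ x ∈ C, f x x = 0)
    (hSP : StronglyPseudomonotone C f γ) (hconv : ∀ x ∈ C, ConvexOn ℝ C (f x))
    (t : Finset (EuclideanSpace ℝ (Fin m))) (ht : (t : Set (EuclideanSpace ℝ (Fin m))) ⊆ C) :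
    convexHull ℝ (t : Set (EuclideanSpace ℝ (Fin m))) ⊆ ⋃ y ∈ t, mintySet C f γ y := by
  intro z hz
  have hzC : z ∈ C := convexHull_min ht hC hz
  by_contra hnot
  simp only [mem_iUnion, not_exists] at hnot
  have hneg : (t : Set (EuclideanSpace ℝ (Fin m))) ⊆ {y | y ∈ C ∧ f z y < 0} := by
    intro y hy
    refine ⟨ht hy, ?_⟩
    by_contra! hnn
    have := hSP z hzC y (ht hy) hnn
    exact hnot y hy ⟨hzC, by linarith⟩
  have := convexHull_min hneg ((hconv z hzC).convex_lt 0) hz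
  exact this.2.ne (hdiag z hzC)

theorem exists_mem_mintySet (hCne : C.Nonempty) (hCclosed : IsClosed C) (hC : Convex ℝ C)
    (hdiag : ∀ x ∈ C, f x x = 0) (hγ : 0 < γ) (hSP : StronglyPseudomonotone C f γ)
    (hconv : ∀ x ∈ C, ConvexOn ℝ C (f x)) (hlsc : ∀ x ∈ C, LowerSemicontinuousOn (f x) C) :
    ∃ x ∈ C, ∀ y ∈ C, f y x + γ * ‖x - y‖ ^ 2 ≤ 0 := by
  classical
  obtain ⟨y₀, hy₀⟩ := hCne
  have hcpt : IsCompact (mintySet C f γ y₀) := Metric.isCompact_of_isClosed_isBounded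
    (isClosed_mintySet hCclosed (hlsc y₀ hy₀))
    (isBounded_mintySet hC hγ hy₀ (hdiag y₀ hy₀) (hconv y₀ hy₀) (hlsc y₀ hy₀))
  obtain ⟨x, hx₀, hx⟩ := hcpt.inter_iInter_nonempty (fun y : C => mintySet C f γ y)
    (fun y => isClosed_mintySet hCclosed (hlsc y y.2)) (by
      intro u
      have hsub : ∀ y ∈ insert y₀ (u.image Subtype.val), y ∈ C := by
        simp only [Finset.mem_insert, Finset.mem_image]
        rintro y (rfl | ⟨y, -, rfl⟩)
        · exact hy₀
        · exact y.2
      obtain ⟨w, hw⟩ := kkm_convex (insert y₀ (u.image Subtype.val)) (mintySet C f γ)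
        (Finset.insert_nonempty _ _)
        (fun y hy => isClosed_mintySet hCclosed (hlsc y (hsub y hy)))
        (fun y hy => convex_mintySet hC hγ (hconv y (hsub y hy)))
        (fun t ht => convexHull_subset_iUnion_mintySet hC hdiag hSP hconv t
          fun y hy => hsub y (ht hy))
      have hw' := fun y hy => (mem_iInter₂.1 hw y hy).1
      exact ⟨w, hw' y₀ (Finset.mem_insert_self _ _), mem_iInter₂.2 fun y hy =>
        hw' y (Finset.mem_insert_of_mem (Finset.mem_image_of_mem _ hy))⟩)
  exact ⟨x, hx₀.1, fun y hy => (mem_iInter.1 hx ⟨y, hy⟩).2⟩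

/-- **Minty's argument**: with `w = x + t (y - x)`, convexity of `f w` gives
`0 = f w w ≤ t * f w y + (1 - t) * f w x ≤ t * f w y`, and hemicontinuity lets `t` tend to `0`. -/
theorem nonneg_of_minty (hC : Convex ℝ C) (hdiag : ∀ x ∈ C, f x x = 0)
    (hconv : ∀ x ∈ C, ConvexOn ℝ C (f x))
    (hhemi : ∀ y ∈ C, HemicontinuousOnSegments C (fun x => f x y))
    {x : EuclideanSpace ℝ (Fin m)} (hx : x ∈ C) (hminty : ∀ y ∈ C, f y x ≤ 0) :
    ∀ y ∈ C, 0 ≤ f x y := by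
  intro y hy
  have hcont : Tendsto (fun t : ℝ => f (x + t • (y - x)) y) (𝓝[>] 0) (𝓝 (f x y)) := by
    have h := hhemi y hy x hx y hy 0 (by simp)
    simp only [ContinuousWithinAt, zero_smul, add_zero] at h
    exact h.mono_left (nhdsWithin_le_of_mem (Icc_mem_nhdsGT zero_lt_one))
  refine ge_of_tendsto hcont ?_
  filter_upwards [Ioc_mem_nhdsGT (zero_lt_one (α := ℝ))] with t ht
  have hw : x + t • (y - x) ∈ C := hC.add_smul_sub_mem hx hy ⟨ht.1.le, ht.2⟩
  have h1 := (hconv _ hw).2 hx hy (by linarith [ht.2] : 0 ≤ 1 - t) ht.1.le (by ring)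
  have h2 : (1 - t) • x + t • y = x + t • (y - x) := by module
  rw [h2, hdiag _ hw] at h1
  simp only [smul_eq_mul] at h1
  have h3 := mul_nonneg (by linarith [ht.2] : 0 ≤ 1 - t) (neg_nonneg.2 (hminty _ hw))
  exact nonneg_of_mul_nonneg_right (by linarith : 0 ≤ t * f (x + t • (y - x)) y) ht.1

theorem exists_solutions_eq_singleton (hCne : C.Nonempty) (hCclosed : IsClosed C)
    (hC : Convex ℝ C) (hdiag : ∀ x ∈ C, f x x = 0) (hγ : 0 < γ)
    (hSP : StronglyPseudomonotone C f γ) (hconv : ∀ x ∈ C, ConvexOn ℝ C (f x))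
    (hlsc : ∀ x ∈ C, LowerSemicontinuousOn (f x) C)
    (hhemi : ∀ y ∈ C, HemicontinuousOnSegments C (fun x => f x y)) :
    ∃ x, solutions C f = {x} := by
  obtain ⟨x, hx, hminty⟩ := exists_mem_mintySet hCne hCclosed hC hdiag hγ hSP hconv hlsc
  have hsol : ∀ y ∈ C, 0 ≤ f x y := nonneg_of_minty hC hdiag hconv hhemi hx fun y hy => by
    have := hminty y hy
    have : 0 ≤ γ * ‖x - y‖ ^ 2 := by positivity
    linarith
  refine ⟨x, Set.eq_singleton_iff_unique_mem.2 ⟨⟨hx, hsol⟩, ?_⟩⟩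
  rintro z ⟨hz, hzsol⟩
  have h1 := hSP x hx z hz (hsol z hz)
  have h2 := hzsol x hx
  have h3 : ‖x - z‖ ^ 2 = 0 := by
    have : γ * ‖x - z‖ ^ 2 ≤ 0 := by linarith
    exact le_antisymm (nonpos_of_mul_nonpos_right this hγ) (sq_nonneg _)
  rw [sq_eq_zero_iff, norm_eq_zero, sub_eq_zero] at h3
  exact h3.symm

end Equilibrium

/-! ### The proximal step and the golden ratio averages -/

section OneStep

variable {m : ℕ} {C : Set (EuclideanSpace ℝ (Fin m))}
  {f : EuclideanSpace ℝ (Fin m) → EuclideanSpace ℝ (Fin m) → ℝ} {γ : ℝ}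

open scoped RealInnerProductSpace

/-- The variational inequality that characterizes the proximal point `p`, from comparing `p` with
`p + t (y - p)` as `t` tends to `0`. -/
theorem IsProx.inner_le {g : EuclideanSpace ℝ (Fin m) → ℝ} {l : ℝ}
    {z p y : EuclideanSpace ℝ (Fin m)} (hp : IsProx C g l z p) (hg : ConvexOn ℝ C g)
    (hl : 0 ≤ l) (hy : y ∈ C) : ⟪z - p, y - p⟫ ≤ l * (g y - g p) := by
  have key : ∀ t ∈ Ioc (0 : ℝ) 1,
      0 ≤ l * (g y - g p) - ⟪z - p, y - p⟫ + t * (1 / 2 * ‖y - p‖ ^ 2) := by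
    intro t ht
    have hw : p + t • (y - p) ∈ C := hg.1.add_smul_sub_mem hp.1 hy ⟨ht.1.le, ht.2⟩
    have h1 : l * g p + 1 / 2 * ‖p - z‖ ^ 2
        ≤ l * g (p + t • (y - p)) + 1 / 2 * ‖p + t • (y - p) - z‖ ^ 2 := hp.2 hw
    have h2 := hg.2 hp.1 hy (by linarith [ht.2] : 0 ≤ 1 - t) ht.1.le (by ring)
    have h3 : (1 - t) • p + t • y = p + t • (y - p) := by module
    rw [h3] at h2
    simp only [smul_eq_mul] at h2
    have h4 : ‖p + t • (y - p) - z‖ ^ 2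
        = ‖p - z‖ ^ 2 - 2 * t * ⟪z - p, y - p⟫ + t ^ 2 * ‖y - p‖ ^ 2 := by
      have : p + t • (y - p) - z = t • (y - p) - (z - p) := by module
      rw [this, norm_sub_sq_real, norm_smul, Real.norm_of_nonneg ht.1.le, inner_smul_left,
        real_inner_comm, norm_sub_rev p z]
      simp only [conj_trivial]
      ring
    have h5 := mul_le_mul_of_nonneg_left h2 hl
    rw [h4] at h1
    have h6 : 0 ≤ t * (l * (g y - g p) - ⟪z - p, y - p⟫ + t * (1 / 2 * ‖y - p‖ ^ 2)) := by
      linarith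
    exact nonneg_of_mul_nonneg_right h6 ht.1
  have hlim : Tendsto (fun t : ℝ => l * (g y - g p) - ⟪z - p, y - p⟫
      + t * (1 / 2 * ‖y - p‖ ^ 2)) (𝓝[>] 0) (𝓝 (l * (g y - g p) - ⟪z - p, y - p⟫)) := by
    have : Continuous fun t : ℝ => l * (g y - g p) - ⟪z - p, y - p⟫
      + t * (1 / 2 * ‖y - p‖ ^ 2) := by fun_prop
    simpa using (this.tendsto 0).mono_left nhdsWithin_le_nhds
  have := ge_of_tendsto hlim (by
    filter_upwards [Ioc_mem_nhdsGT (zero_lt_one (α := ℝ))] with t ht using key t ht)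
  linarith

local notation "φ" => Real.goldenRatio

/-- Distances to `a` from a point `p` and from its golden ratio average with `b`. -/
theorem norm_sq_goldenRatio_average (p b a : EuclideanSpace ℝ (Fin m)) :
    ‖p - a‖ ^ 2 = φ ^ 2 * ‖φ⁻¹ • ((φ - 1) • p + b) - a‖ ^ 2 - φ * ‖b - a‖ ^ 2
      + (φ - 1) * ‖p - b‖ ^ 2 := by
  have hφ := Real.goldenRatio_sq
  have h1 : φ⁻¹ • ((φ - 1) • p + b) - a = φ⁻¹ • ((φ - 1) • (p - a) + (b - a)) := by
    have h : φ⁻¹ • ((φ - 1) • (p - a) + (b - a)) = φ⁻¹ • ((φ - 1) • p + b) - (φ⁻¹ * φ) • a := by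
      module
    rw [h, inv_mul_cancel₀ Real.goldenRatio_ne_zero, one_smul]
  have h2 : p - b = (p - a) - (b - a) := by abel
  have h3 : φ ^ 2 * ‖φ⁻¹ • ((φ - 1) • p + b) - a‖ ^ 2 = ‖(φ - 1) • (p - a) + (b - a)‖ ^ 2 := by
    rw [h1, norm_smul, mul_pow, ← mul_assoc, Real.norm_of_nonneg (by positivity), ← mul_pow,
      mul_inv_cancel₀ Real.goldenRatio_ne_zero, one_pow, one_mul]
  rw [h3, h2, norm_add_sq_real, norm_sub_sq_real (p - a), norm_smul, mul_pow, Real.norm_eq_abs,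
    sq_abs, inner_smul_left]
  simp only [conj_trivial]
  linear_combination (-‖p - a‖ ^ 2) * hφ

/-- The energy estimate for one step: `x₀, x₁, x₂` are consecutive iterates, `b₀, b₁` the averages
that belong to `x₀, x₁`, and `l₀, l₁, l₂` the step sizes. It adds the variational inequality of `x₂`
tested at the solution `a` to that of `x₁` tested at `x₂`. -/
theorem energy_step (hconv : ∀ x ∈ C, ConvexOn ℝ C (f x))
    {x₀ x₁ x₂ b₀ b₁ a : EuclideanSpace ℝ (Fin m)} {l₀ l₁ l₂ μ : ℝ}
    (hx₀ : x₀ ∈ C) (ha : a ∈ C) (hl₀ : 0 < l₀) (hl₁ : 0 < l₁) (hl₂ : 0 < l₂)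
    (hl : l₁ ≤ l₀) (hp₁ : IsProx C (f x₀) l₀ b₀ x₁) (hp₂ : IsProx C (f x₁) l₁ b₁ x₂)
    (hb₁ : b₁ = φ⁻¹ • ((φ - 1) • x₁ + b₀)) (hfa : f x₁ a ≤ -γ * ‖a - x₁‖ ^ 2)
    (hstep : 2 * l₂ * (f x₀ x₂ - f x₀ x₁ - f x₁ x₂) ≤ μ * (‖x₀ - x₁‖ ^ 2 + ‖x₁ - x₂‖ ^ 2)) :
    φ ^ 2 * ‖φ⁻¹ • ((φ - 1) • x₂ + b₁) - a‖ ^ 2 + 2 * γ * l₁ * ‖x₁ - a‖ ^ 2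
        + l₁ / l₀ * φ * (‖b₁ - x₁‖ ^ 2 + ‖x₁ - x₂‖ ^ 2)
      ≤ φ ^ 2 * ‖b₁ - a‖ ^ 2 + l₁ / l₂ * μ * (‖x₀ - x₁‖ ^ 2 + ‖x₁ - x₂‖ ^ 2) := by
  have h1 := hp₂.inner_le (hconv x₁ hp₁.1) hl₁.le ha
  have h0 := hp₁.inner_le (hconv x₀ hx₀) hl₀.le hp₂.1
  have hb : b₀ - x₁ = φ • (b₁ - x₁) := by
    rw [hb₁, smul_sub, smul_inv_smul₀ Real.goldenRatio_ne_zero]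
    module
  rw [hb, inner_smul_left, conj_trivial] at h0
  have e1 : ⟪b₁ - x₂, a - x₂⟫ = (‖x₂ - b₁‖ ^ 2 + ‖x₂ - a‖ ^ 2 - ‖b₁ - a‖ ^ 2) / 2 := by
    have : b₁ - a = (b₁ - x₂) - (a - x₂) := by abel
    rw [this, norm_sub_sq_real (b₁ - x₂), norm_sub_rev x₂ b₁, norm_sub_rev x₂ a]
    ring
  have e0 : ⟪b₁ - x₁, x₂ - x₁⟫ = (‖b₁ - x₁‖ ^ 2 + ‖x₁ - x₂‖ ^ 2 - ‖x₂ - b₁‖ ^ 2) / 2 := by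
    have : x₂ - b₁ = (x₂ - x₁) - (b₁ - x₁) := by abel
    rw [this, norm_sub_sq_real (x₂ - x₁), norm_sub_rev x₁ x₂, real_inner_comm]
    ring
  rw [e1] at h1
  rw [e0] at h0
  have hgold := norm_sq_goldenRatio_average x₂ b₁ a
  have hφ := Real.goldenRatio_sq
  have h0' : l₁ / l₀ * (φ * ((‖b₁ - x₁‖ ^ 2 + ‖x₁ - x₂‖ ^ 2 - ‖x₂ - b₁‖ ^ 2) / 2))
      ≤ l₁ * (f x₀ x₂ - f x₀ x₁) := by
    have := mul_le_mul_of_nonneg_left h0 (div_pos hl₁ hl₀).le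
    rwa [← mul_assoc (l₁ / l₀) l₀, div_mul_cancel₀ _ hl₀.ne'] at this
  have hstep' : 2 * l₁ * (f x₀ x₂ - f x₀ x₁ - f x₁ x₂)
      ≤ l₁ / l₂ * μ * (‖x₀ - x₁‖ ^ 2 + ‖x₁ - x₂‖ ^ 2) := by
    have := mul_le_mul_of_nonneg_left hstep (div_pos hl₁ hl₂).le
    have e : l₁ / l₂ * (2 * l₂ * (f x₀ x₂ - f x₀ x₁ - f x₁ x₂))
      = 2 * l₁ * (f x₀ x₂ - f x₀ x₁ - f x₁ x₂) := by field_simp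
    rw [e] at this
    linarith
  have hfa' : l₁ * f x₁ a ≤ l₁ * (-γ * ‖x₁ - a‖ ^ 2) := by
    rw [norm_sub_rev x₁ a]
    exact mul_le_mul_of_nonneg_left hfa hl₁.le
  have hθ : 0 ≤ φ * (1 - l₁ / l₀) * ‖x₂ - b₁‖ ^ 2 := by
    have : l₁ / l₀ ≤ 1 := (div_le_one hl₀).2 hl
    have := sub_nonneg.2 this
    positivity
  rw [hgold] at h1
  linear_combination 2 * h1 + 2 * h0' + hstep' + 2 * hfa' + hθ - (‖b₁ - a‖ ^ 2) * hφ

end OneStep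

/-! ### The step sizes -/

section StepSize

theorem nextStep_le (μ l A t : ℝ) : nextStep μ l A t ≤ l := by
  unfold nextStep
  split_ifs
  · exact le_rfl
  · exact min_le_left _ _

theorem two_mul_nextStep_mul_le {μ l A : ℝ} (t : ℝ) (hμ : 0 ≤ μ) (hl : 0 ≤ l) (hA : 0 ≤ A) :
    2 * nextStep μ l A t * t ≤ μ * A := by
  have hμA := mul_nonneg hμ hA
  unfold nextStep
  split_ifs with h
  · have : t ≤ 0 := max_eq_left_iff.1 h
    have := mul_nonneg hl (neg_nonneg.2 this)
    linarith
  · have ht : 0 < t := by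
      by_contra! h'
      exact h (max_eq_left h')
    rw [max_eq_right ht.le]
    have := (le_div_iff₀ (by positivity)).1 (min_le_right l (μ * A / (2 * t)))
    linarith

theorem min_le_nextStep {μ l A t c : ℝ} (hμ : 0 ≤ μ) (hc : 0 < c) (ht : t ≤ c * A) :
    min l (μ / (2 * c)) ≤ nextStep μ l A t := by
  unfold nextStep
  split_ifs with h
  · exact min_le_left _ _
  · have ht0 : 0 < t := by
      by_contra! h'
      exact h (max_eq_left h')
    rw [max_eq_right ht0.le]
    refine min_le_min le_rfl ?_
    rw [div_le_div_iff₀ (by positivity) (by positivity)]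
    have := mul_le_mul_of_nonneg_left ht hμ
    linarith

/-- Consecutive terms of an antitone sequence with a positive lower bound have ratio close to
`1`. -/
theorem eventually_mul_le_succ {l : ℕ → ℝ} (hl : Antitone l) {c ρ : ℝ} (hc : 0 < c)
    (hlc : ∀ n, c ≤ l n) (hρ₀ : 0 < ρ) (hρ : ρ < 1) : ∀ᶠ n in atTop, ρ * l n ≤ l (n + 1) := by
  have hbdd : BddBelow (range l) := ⟨c, by rintro _ ⟨n, rfl⟩; exact hlc n⟩
  have hL : c ≤ ⨅ n, l n := le_ciInf hlc
  have hlt : ⨅ n, l n < (⨅ n, l n) / ρ := by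
    rw [lt_div_iff₀ hρ₀]
    nlinarith
  filter_upwards [(tendsto_atTop_ciInf hl hbdd).eventually_lt_const hlt] with n hn
  rw [lt_div_iff₀ hρ₀] at hn
  have := ciInf_le hbdd (n + 1)
  linarith

end StepSize

/-! ### Linear convergence -/

section Convergence

variable {m : ℕ} {C : Set (EuclideanSpace ℝ (Fin m))}
  {f : EuclideanSpace ℝ (Fin m) → EuclideanSpace ℝ (Fin m) → ℝ} {γ : ℝ}

theorem rLinearlyConvergesTo_of_sq_le {u : ℕ → EuclideanSpace ℝ (Fin m)}
    {a : EuclideanSpace ℝ (Fin m)} {M q : ℝ} (hq₀ : 0 ≤ q) (hq : q < 1)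
    (h : ∀ᶠ n in atTop, ‖u n - a‖ ^ 2 ≤ M * q ^ n) : RLinearlyConvergesTo u a := by
  -- Any `r < 1` with `q < r ^ 2` absorbs the constant `M`.
  set r := (1 + q) / 2 with hr
  have hr₀ : 0 < r := by positivity
  have hr₁ : r < 1 := by rw [hr]; linarith
  have hqr : q < r ^ 2 := by
    have : 0 < (1 - q) ^ 2 := by have := sub_pos.2 hq; positivity
    rw [hr]
    linarith
  have hM : ∀ᶠ n in atTop, M * (q / r ^ 2) ^ n < 1 := by
    have := (tendsto_pow_atTop_nhds_zero_of_lt_one (by positivity : 0 ≤ q / r ^ 2)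
      ((div_lt_one (by positivity)).2 hqr)).const_mul M
    rw [mul_zero] at this
    exact this.eventually_lt_const zero_lt_one
  have hle : ∀ᶠ n in atTop, ‖u n - a‖ ≤ r ^ n := by
    filter_upwards [h, hM] with n h1 h2
    refine le_of_sq_le_sq (h1.trans ?_) (by positivity)
    rw [div_pow, ← mul_div_assoc, div_lt_one (by positivity)] at h2
    rw [← pow_mul, mul_comm n 2, pow_mul]
    exact h2.le
  refine ⟨?_, ?_⟩
  · rw [tendsto_iff_norm_sub_tendsto_zero]
    exact squeeze_zero' (Eventually.of_forall fun n => norm_nonneg _) hle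
      (tendsto_pow_atTop_nhds_zero_of_lt_one hr₀.le hr₁)
  · refine lt_of_le_of_lt (b := (r : EReal)) ?_ (by exact_mod_cast hr₁)
    refine limsup_le_of_le (by isBoundedDefault) ?_
    filter_upwards [hle, eventually_ge_atTop 1] with n h1 hn
    rw [EReal.coe_le_coe_iff]
    calc ‖u n - a‖ ^ ((1 : ℝ) / n) ≤ (r ^ n) ^ ((1 : ℝ) / n) :=
          Real.rpow_le_rpow (norm_nonneg _) h1 (by positivity)
      _ = r := by rw [one_div]; exact Real.pow_rpow_inv_natCast hr₀.le (by omega)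

local notation "φ" => Real.goldenRatio

theorem IsGenerated.mem {μ : ℝ} {x xbar : ℤ → EuclideanSpace ℝ (Fin m)} {lam : ℕ → ℝ}
    (h : IsGenerated C f μ x xbar lam) : ∀ n : ℕ, x n ∈ C
  | 0 => h.x_zero_mem
  | n + 1 => by simpa using (h.x_succ n).1

theorem IsGenerated.antitone {μ : ℝ} {x xbar : ℤ → EuclideanSpace ℝ (Fin m)} {lam : ℕ → ℝ}
    (h : IsGenerated C f μ x xbar lam) : Antitone lam :=
  antitone_nat_of_succ_le fun n => by
    rw [h.lam_succ n]
    exact nextStep_le _ _ _ _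

/-- The Lipschitz-type condition keeps the step sizes away from `0`. -/
theorem IsGenerated.exists_pos_le {μ : ℝ} {x xbar : ℤ → EuclideanSpace ℝ (Fin m)} {lam : ℕ → ℝ}
    (h : IsGenerated C f μ x xbar lam) (hLC : LipschitzType C f) :
    ∃ l > 0, ∀ n, l ≤ lam n := by
  obtain ⟨c₁, c₂, hc₁, hc₂, hLC⟩ := hLC
  have hμ := h.mu_pos
  have hc : 0 < max c₁ c₂ := lt_max_of_lt_left hc₁
  refine ⟨min (lam 0) (μ / (2 * max c₁ c₂)), lt_min h.lam_zero_pos (by positivity), fun n => ?_⟩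
  induction n with
  | zero => exact min_le_left _ _
  | succ n ih =>
    refine (le_min ih (min_le_right _ _)).trans ?_
    rw [h.lam_succ n]
    refine min_le_nextStep hμ.le hc ?_
    have hprev : x ((n : ℤ) - 1) ∈ C := by
      cases n with
      | zero => simpa using h.x_neg_one_mem
      | succ k => simpa using h.mem k
    have h1 := hLC _ hprev _ (h.mem n) _ (h.x_succ n).1
    have h2 := mul_le_mul_of_nonneg_right (le_max_left c₁ c₂)
      (sq_nonneg ‖x ((n : ℤ) - 1) - x n‖)
    have h3 := mul_le_mul_of_nonneg_right (le_max_right c₁ c₂)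
      (sq_nonneg ‖x n - x ((n : ℤ) + 1)‖)
    linarith

/-- `energy_step` along the generated sequences. -/
theorem IsGenerated.energy_le {μ : ℝ} {x xbar : ℤ → EuclideanSpace ℝ (Fin m)} {lam : ℕ → ℝ}
    (h : IsGenerated C f μ x xbar lam) (hSP : StronglyPseudomonotone C f γ)
    (hconv : ∀ x ∈ C, ConvexOn ℝ C (f x)) (hpos : ∀ n, 0 < lam n)
    {a : EuclideanSpace ℝ (Fin m)} (ha : a ∈ solutions C f) (n : ℕ) :
    φ ^ 2 * ‖xbar (n + 2 : ℕ) - a‖ ^ 2 + 2 * γ * lam (n + 1) * ‖x (n + 1 : ℕ) - a‖ ^ 2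
        + lam (n + 1) / lam n * φ * (‖xbar (n + 1 : ℕ) - x (n + 1 : ℕ)‖ ^ 2
          + ‖x (n + 1 : ℕ) - x (n + 2 : ℕ)‖ ^ 2)
      ≤ φ ^ 2 * ‖xbar (n + 1 : ℕ) - a‖ ^ 2 + lam (n + 1) / lam (n + 2) * μ *
          (‖x n - x (n + 1 : ℕ)‖ ^ 2 + ‖x (n + 1 : ℕ) - x (n + 2 : ℕ)‖ ^ 2) := by
  have hp (k : ℕ) : ((k + 1 : ℕ) : ℤ) - 1 = k := by push_cast; ring
  have hs (k : ℕ) : (k : ℤ) + 1 = (k + 1 : ℕ) := by push_cast; ring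
  have hb (k : ℕ) : xbar (k + 1 : ℕ) = φ⁻¹ • ((φ - 1) • x (k + 1 : ℕ) + xbar k) := by
    rw [h.xbar_eq (k + 1), hp]
  have hx (k : ℕ) : IsProx C (f (x k)) (lam k) (xbar k) (x (k + 1 : ℕ)) := by
    rw [← hs]
    exact h.x_succ k
  have hlam := h.lam_succ (n + 1)
  rw [hp, hs] at hlam
  rw [hb (n + 1)]
  refine energy_step hconv (h.mem n) ha.1 (hpos n) (hpos (n + 1)) (hpos (n + 2))
    (h.antitone n.le_succ) (hx n) (hx (n + 1)) (hb n)
    (hSP a ha.1 _ (h.mem (n + 1)) (ha.2 _ (h.mem (n + 1)))) ?_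
  rw [hlam]
  exact two_mul_nextStep_mul_le _ h.mu_pos.le (hpos (n + 1)).le (by positivity)

/-- One step of the contraction, with `B, B'` the squared distances of two consecutive averages to
the solution, `A, A'` the squared lengths of two consecutive steps, `X` the squared distance of the
iterate to the solution and `D` that of the iterate to its average. -/
theorem energy_contraction {w p s g d κ B B' A A' X D : ℝ} (hw : 0 < w) (hp : 0 < p)
    (hA : 0 ≤ A) (hB : 0 ≤ B) (hX : 0 ≤ X) (hD : 0 ≤ D) (hκg : κ ≤ g) (hκd : 2 * κ ≤ d)
    (hκ : 0 ≤ κ)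
    (hBXD : B ≤ 2 * X + 2 * D)
    (h : w * B' + 2 * g * X + d * D + p * A' ≤ w * B + s * A) :
    w * B' + p * A' ≤ max (1 - κ / w) (s / p) * (w * B + p * A) := by
  have h1 : (1 - κ / w) * (w * B) ≤ max (1 - κ / w) (s / p) * (w * B) :=
    mul_le_mul_of_nonneg_right (le_max_left _ _) (by positivity)
  have h2 : s / p * (p * A) ≤ max (1 - κ / w) (s / p) * (p * A) :=
    mul_le_mul_of_nonneg_right (le_max_right _ _) (by positivity)
  have e1 : (1 - κ / w) * (w * B) = w * B - κ * B := by field_simp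
  have e2 : s / p * (p * A) = s * A := by field_simp
  have h3 := mul_le_mul_of_nonneg_left hBXD hκ
  have h4 := mul_le_mul_of_nonneg_right hκg hX
  have h5 := mul_le_mul_of_nonneg_right hκd hD
  linarith

theorem IsGenerated.rLinearlyConvergesTo {μ : ℝ} {x xbar : ℤ → EuclideanSpace ℝ (Fin m)}
    {lam : ℕ → ℝ} (h : IsGenerated C f μ x xbar lam) (hγ : 0 < γ)
    (hSP : StronglyPseudomonotone C f γ) (hLC : LipschitzType C f)
    (hconv : ∀ x ∈ C, ConvexOn ℝ C (f x)) {a : EuclideanSpace ℝ (Fin m)}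
    (ha : a ∈ solutions C f) : RLinearlyConvergesTo (fun n : ℕ => x n) a := by
  obtain ⟨l, hl, hlam⟩ := h.exists_pos_le hLC
  have hpos : ∀ n, 0 < lam n := fun n => hl.trans_le (hlam n)
  have hφ := Real.goldenRatio_pos
  have hμ := h.mu_pos
  have hσ₀ : 0 < 2 * μ / φ := by positivity
  have hσ₁ : 2 * μ / φ < 1 := by
    rw [div_lt_one hφ]
    linarith [h.mu_lt]
  -- The ratio `ρ < 1` is so close to `1` that the step size ratios keep `s < p` below.
  obtain ⟨ρ, hρ₀, hρ₁, hρ⟩ : ∃ ρ : ℝ, 0 < ρ ∧ ρ < 1 ∧ 2 * μ < ρ ^ 2 * φ := by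
    refine ⟨(1 + 2 * μ / φ) / 2, by positivity, by linarith, ?_⟩
    rw [← div_lt_iff₀ hφ]
    have := pow_pos (sub_pos.2 hσ₁) 2
    linarith
  set s := μ / ρ with hs
  set p := ρ * φ - s with hp
  have hs₀ : 0 < s := by positivity
  have hsp : s < p := by
    have : 2 * μ / ρ < ρ * φ := by
      rw [div_lt_iff₀ hρ₀]
      linarith
    rw [hp, hs]
    linarith [mul_div_assoc 2 μ ρ]
  have hp₀ : 0 < p := hs₀.trans hsp
  set κ := min (γ * l) (ρ * φ / 2) with hκ
  have hκ₀ : 0 < κ := lt_min (by positivity) (by positivity)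
  set q := max (1 - κ / φ ^ 2) (s / p) with hq
  have hq₀ : 0 < q := lt_max_of_lt_right (by positivity)
  have hq₁ : q < 1 := max_lt (sub_lt_self 1 (by positivity)) ((div_lt_one hp₀).2 hsp)
  set e : ℕ → ℝ := fun n =>
    φ ^ 2 * ‖xbar (n + 1 : ℕ) - a‖ ^ 2 + p * ‖x n - x (n + 1 : ℕ)‖ ^ 2 with he
  obtain ⟨N, hN⟩ := eventually_atTop.1 (eventually_mul_le_succ h.antitone hl hlam hρ₀ hρ₁)
  have hmain : ∀ n ≥ N, φ ^ 2 * ‖xbar (n + 2 : ℕ) - a‖ ^ 2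
      + 2 * (γ * l) * ‖x (n + 1 : ℕ) - a‖ ^ 2
      + ρ * φ * ‖xbar (n + 1 : ℕ) - x (n + 1 : ℕ)‖ ^ 2
      + p * ‖x (n + 1 : ℕ) - x (n + 2 : ℕ)‖ ^ 2
      ≤ φ ^ 2 * ‖xbar (n + 1 : ℕ) - a‖ ^ 2 + s * ‖x n - x (n + 1 : ℕ)‖ ^ 2 := by
    intro n hn
    have h0 := h.energy_le hSP hconv hpos ha n
    have r1 : ρ ≤ lam (n + 1) / lam n := (le_div_iff₀ (hpos n)).2 (hN n hn)
    have r2 : lam (n + 1) / lam (n + 2) * μ ≤ s := by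
      rw [hs, div_mul_eq_mul_div, div_le_div_iff₀ (hpos _) hρ₀]
      have := mul_le_mul_of_nonneg_left (hN (n + 1) (by omega)) hμ.le
      linarith
    have h1 := mul_le_mul_of_nonneg_right (mul_le_mul_of_nonneg_right r1 hφ.le)
      (by positivity : 0 ≤ ‖xbar (n + 1 : ℕ) - x (n + 1 : ℕ)‖ ^ 2
          + ‖x (n + 1 : ℕ) - x (n + 2 : ℕ)‖ ^ 2)
    have h2 := mul_le_mul_of_nonneg_right r2
      (by positivity : 0 ≤ ‖x n - x (n + 1 : ℕ)‖ ^ 2 + ‖x (n + 1 : ℕ) - x (n + 2 : ℕ)‖ ^ 2)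
    have h3 : γ * l * ‖x (n + 1 : ℕ) - a‖ ^ 2 ≤ γ * lam (n + 1) * ‖x (n + 1 : ℕ) - a‖ ^ 2 := by
      gcongr
      exact hlam _
    rw [hp]
    linarith
  have hcontr : ∀ n ≥ N, e (n + 1) ≤ q * e n := by
    intro n hn
    refine energy_contraction (by positivity) hp₀ (by positivity) (by positivity) (sq_nonneg _)
      (sq_nonneg _) (min_le_left _ _) ?_ hκ₀.le ?_ (hmain n hn)
    · linarith [min_le_right (γ * l) (ρ * φ / 2)]
    · have h1 := norm_sub_le_norm_sub_add_norm_sub (xbar (n + 1 : ℕ)) (x (n + 1 : ℕ)) a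
      have h2 := pow_le_pow_left₀ (norm_nonneg _) h1 2
      have h3 := add_sq_le (a := ‖xbar (n + 1 : ℕ) - x (n + 1 : ℕ)‖) (b := ‖x (n + 1 : ℕ) - a‖)
      linarith
  have hgeom : ∀ n ≥ N, e n ≤ e N / q ^ N * q ^ n := by
    intro n hn
    induction n, hn using Nat.le_induction with
    | base => rw [div_mul_cancel₀ _ (by positivity)]
    | succ n hn ih =>
      have := mul_le_mul_of_nonneg_left ih hq₀.le
      rw [pow_succ]
      linarith [hcontr n hn]
  refine rLinearlyConvergesTo_of_sq_le (M := e N / q ^ N / (2 * (γ * l) * q)) hq₀.le hq₁ ?_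
  filter_upwards [eventually_ge_atTop (N + 1)] with n hn
  obtain ⟨k, rfl⟩ : ∃ k, n = k + 1 := ⟨n - 1, by omega⟩
  have hk : N ≤ k := by omega
  have h1 : 2 * (γ * l) * ‖x (k + 1 : ℕ) - a‖ ^ 2 ≤ e N / q ^ N * q ^ k := by
    refine le_trans ?_ (hgeom k hk)
    have h2 := mul_le_mul_of_nonneg_right hsp.le (sq_nonneg ‖x k - x (k + 1 : ℕ)‖)
    have h3 : 0 ≤ φ ^ 2 * ‖xbar (k + 2 : ℕ) - a‖ ^ 2
      + ρ * φ * ‖xbar (k + 1 : ℕ) - x (k + 1 : ℕ)‖ ^ 2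
      + p * ‖x (k + 1 : ℕ) - x (k + 2 : ℕ)‖ ^ 2 := by positivity
    simp only [he]
    linarith [hmain k hk]
  have h2 : e N / q ^ N / (2 * (γ * l) * q) * q ^ (k + 1)
      = e N / q ^ N * q ^ k / (2 * (γ * l)) := by
    rw [pow_succ]
    field_simp
  rw [h2, le_div_iff₀ (by positivity)]
  linarith

end Convergence

end EGRA

theorem theorem2 {m : ℕ} (C : Set (EuclideanSpace ℝ (Fin m)))
    (hCne : C.Nonempty) (hCclosed : IsClosed C) (hCconv : Convex ℝ C)
    (f : EuclideanSpace ℝ (Fin m) → EuclideanSpace ℝ (Fin m) → ℝ)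
    (hfdiag : ∀ x ∈ C, f x x = 0)
    (γ : ℝ) (hγ : 0 < γ) (hSP : EGRA.StronglyPseudomonotone C f γ)
    (hLC : EGRA.LipschitzType C f)
    (hconv : ∀ x ∈ C, ConvexOn ℝ C (f x))
    (hlsc : ∀ x ∈ C, LowerSemicontinuousOn (f x) C)
    (hhemi : ∀ y ∈ C, EGRA.HemicontinuousOnSegments C (fun x => f x y)) :
    ∃ xd : EuclideanSpace ℝ (Fin m), EGRA.solutions C f = {xd} ∧
      ∀ (μ : ℝ) (x xbar : ℤ → EuclideanSpace ℝ (Fin m)) (lam : ℕ → ℝ),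
        EGRA.IsGenerated C f μ x xbar lam →
          EGRA.RLinearlyConvergesTo (fun n : ℕ => x n) xd := by
  obtain ⟨xd, hxd⟩ := EGRA.exists_solutions_eq_singleton hCne hCclosed hCconv hfdiag hγ hSP hconv
    hlsc hhemi
  exact ⟨xd, hxd, fun μ x xbar lam h => h.rLinearlyConvergesTo hγ hSP hLC hconv (hxd ▸ rfl)⟩
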